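/- **Conventions.** A variety of groups is a class of groups closed under subgroups, homomorphic images and unrestricted direct products; it is proper if it is not the class of all groups. For a variety $\mathfrak B$ and an alphabet $\Sigma$, let $\langle\mathfrak w_{\mathfrak B}\rangle\le F(\Sigma)$ (the subgroup generated by the laws) be the smallest normal subgroup of the free group $F(\Sigma)$ with quotient in $\mathfrak B$, and put $F_{\mathfrak B}(\Sigma)=F(\Sigma)/\langle\mathfrak w_{\mathfrak B}\rangle$. A group is recursively (finitely) presented if it has a presentation with finitely many generators and a recursive (finite) set of relators. A *variety of recursively (finitely) presented groups* $\mathfrak A$ is the class of all recursively (finitely) presented groups in a variety $\mathfrak B$, provided that $F_{\mathfrak B}(\Sigma)\in\mathfrak A$ for all finite $\Sigma$; it is proper if $\mathfrak B$ is, and one writes $\mathfrak w_{\mathfrak A}=\mathfrak w_{\mathfrak B}$. As input of an algorithm, a group $K\in\mathfrak A$ is given by a recursive presentation (the number of generators and a program that decides which words in the generators are relators) if $\mathfrak A$ is a variety of recursively presented groups, and by a finite presentation if $\mathfrak A$ is a variety of finitely presented groups. Elements of $K$ are given by words in the generators, finitely generated subgroups by finite lists of generators, and homomorphisms $F(\Sigma)\to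 K$ by the images of the letters. Algorithms need only halt with the correct answer on inputs of the stated kind. An instance of the $\mathfrak A$-PCP is a tuple $(\Sigma,K,g,h)$ with $\Sigma$ a finite alphabet, $K\in\mathfrak A$, and $g,h\colon F(\Sigma)\to K$ homomorphisms; put $\operatorname{Eq}(g,h)=\{x\in F(\Sigma): g(x)=h(x)\}$. The $\mathfrak A$-NPCP is the decision problem: given such $(\Sigma,K,g,h)$ and $u_1,u_2,v_1,v_2\in K$, is there $x\in F(\Sigma)\setminus\{1\}$ such that $u_1g(x)u_2=v_1h(x)v_2$? **Proposition.** Let $\mathfrak A$ be a proper variety of recursively presented groups, or a proper variety of finitely presented groups. Suppose the following hold. 1. There is an algorithm with input an instance $(\Sigma,K,g,h)$ of the $\mathfrak A$-PCP and output a finite set $S\subset F(\Sigma)$ such that $\operatorname{Eq}(g,h)=\langle S,\mathfrak w_{\mathfrak A}\rangle$. 2. There is an algorithm with input a group $K\in\mathfrak A$, two finitely generated subgroups $A,B\le K$ and an element $x\in K$, which determines whether $x\in AB$. Then the $\mathfrak A$-NPCP is decidable. The same holds non-uniformly in the group: if, for each presentation (of the kind above) of a group $K\in\mathfrak A$, there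 are algorithms as in 1 and 2 for inputs with this presentation fixed, then for each such presentation the NPCP for inputs with this presentation fixed is decidable. -/

import Mathlib

open scoped Pointwise

/-! ### Varieties of groups -/

/-- A variety of groups: a class of groups closed under taking subgroups, homomorphic images
(in particular isomorphic copies) and unrestricted direct products. -/
structure GroupVariety where
  /-- membership of a group in the class -/
  Mem : ∀ (G : Type) [Group G], Prop
  subgroup : ∀ {G : Type} [Group G] (H : Subgroup G), Mem G → Mem H
  image : ∀ {G H : Type} [Group G] [Group H] (f : G →* H), Function.Surjective f → Mem G → Mem H
  pi : ∀ {ι : Type} (G : ι → Type) [∀ i, Group (G i)], (∀ i, Mem (G i)) → Mem (∀ i, G i)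

namespace GroupVariety

/-- A variety is proper if it is not the class of all groups. -/
def IsProper (B : GroupVariety) : Prop := ¬ ∀ (G : Type) [Group G], B.Mem G

/-- The subgroup of `F(α)` generated by the laws of the variety: the minimal normal subgroup `N`
of the free group `F(α)` such that `F(α) / N` is in the variety. -/
def lawSubgroup (B : GroupVariety) (α : Type) : Subgroup (FreeGroup α) :=
  sInf {N | ∃ _ : N.Normal, B.Mem (FreeGroup α ⧸ N)}

instance lawSubgroup_normal (B : GroupVariety) (α : Type) : (B.lawSubgroup α).Normal := by
  unfold lawSubgroup
  rw [sInf_eq_iInf']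
  exact Subgroup.normal_iInf_normal fun N => N.2.1

/-- The infimum in the definition of `lawSubgroup` is attained: the quotient is in the variety. -/
theorem mem_quotient_lawSubgroup (B : GroupVariety) (α : Type) :
    B.Mem (FreeGroup α ⧸ B.lawSubgroup α) := by
  let I : Type := {N : Subgroup (FreeGroup α) // ∃ _ : N.Normal, B.Mem (FreeGroup α ⧸ N)}
  have hn : ∀ N : I, N.1.Normal := fun N => N.2.1
  let f : FreeGroup α →* (∀ N : I, FreeGroup α ⧸ N.1) :=
    MonoidHom.pi fun N => QuotientGroup.mk' N.1
  have hker : f.ker = B.lawSubgroup α := by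
    ext x
    simp only [MonoidHom.mem_ker, lawSubgroup, Subgroup.mem_sInf, funext_iff]
    constructor
    · intro h N hN
      have := hN.1
      exact (QuotientGroup.eq_one_iff x).1 (h ⟨N, hN⟩)
    · exact fun h N => (QuotientGroup.eq_one_iff x).2 (h N.1 N.2)
  have e : f.range ≃* FreeGroup α ⧸ B.lawSubgroup α :=
    (QuotientGroup.quotientKerEquivRange f).symm.trans (QuotientGroup.quotientMulEquivOfEq hker)
  exact B.image e.toMonoidHom e.surjective
    (B.subgroup f.range (B.pi (fun N : I => FreeGroup α ⧸ N.1) fun N => N.2.2))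

/-- The free group of the variety on the alphabet `α`. -/
abbrev FreeObject (B : GroupVariety) (α : Type) : Type := FreeGroup α ⧸ B.lawSubgroup α

end GroupVariety

/-! ### Words and presentations as data -/

/-- A word in letters `x₀, x₁, …` and their inverses: the letter `(i, true)` is `xᵢ` and
`(i, false)` is `xᵢ⁻¹`. -/
abbrev Word : Type := List (ℕ × Bool)

namespace Word

/-- `w` is a word over the alphabet `x₀, …, xₙ₋₁`. -/
def On (n : ℕ) (w : Word) : Prop := ∀ l ∈ w, l.1 < n

/-- The value of a word when `xᵢ` takes the value `x i`. Only used for words over `x₀, …, xₙ₋₁`;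
letters outside the alphabet are given the value `1`. -/
def eval {G : Type} [Group G] {n : ℕ} (x : Fin n → G) (w : Word) : G :=
  (w.map fun l => if h : l.1 < n then (if l.2 then x ⟨l.1, h⟩ else (x ⟨l.1, h⟩)⁻¹) else 1).prod

/-- The element of the free group `F(x₀, …, xₙ₋₁)` represented by a word. -/
def toFree (n : ℕ) (w : Word) : FreeGroup (Fin n) := w.eval FreeGroup.of

end Word

/-- A type of finite descriptions of group presentations with finitely many generators
`x₀, …, xₙ₋₁`, to be used as input of algorithms. -/
class PresentationData (P : Type) where
  /-- which pieces of data do describe a presentation -/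
  Valid : P → Prop
  /-- the number `n` of generators -/
  rank : P → ℕ
  /-- the relators, as words over the generators -/
  relators : P → Set Word

/-- A finite presentation: the number of generators and the list of relators. -/
abbrev FinPresentation : Type := ℕ × List Word

instance : PresentationData FinPresentation where
  Valid p := ∀ r ∈ p.2, r.On p.1
  rank p := p.1
  relators p := {r | r ∈ p.2}

/-- A recursive presentation: the number of generators and a program that decides, for words over
the generators, whether they are relators. -/
abbrev RecPresentation : Type := ℕ × Nat.Partrec.Code

instance : PresentationData RecPresentation where
  Valid p := ∀ w : Word, w.On p.1 → ∃ b : Bool, Encodable.encode b ∈ p.2.eval (Encodable.encode w)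
  rank p := p.1
  relators p := {w | w.On p.1 ∧ Encodable.encode true ∈ p.2.eval (Encodable.encode w)}

section Presentations

variable {P : Type} [PresentationData P]

/-- The group defined by a presentation. -/
abbrev PresentationData.Grp (p : P) : Type :=
  PresentedGroup (Word.toFree (rank p) '' relators p)

/-- The element represented by a word in the group defined by a presentation. -/
def PresentationData.value (p : P) (w : Word) : Grp p :=
  w.eval fun i : Fin (rank p) => (PresentedGroup.of i : Grp p)

end Presentations

open PresentationData

/-- A group is recursively presented if it admits a recursive presentation. -/
def IsRecursivelyPresented (G : Type) [Group G] : Prop :=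
  ∃ p : RecPresentation, Valid p ∧ Nonempty (G ≃* Grp p)

/-- The class of the finitely presented groups in the variety `B`. -/
def GroupVariety.FinPres (B : GroupVariety) (G : Type) [Group G] : Prop :=
  B.Mem G ∧ Group.IsFinitelyPresented G

/-- The class of the recursively presented groups in the variety `B`. -/
def GroupVariety.RecPres (B : GroupVariety) (G : Type) [Group G] : Prop :=
  B.Mem G ∧ IsRecursivelyPresented G

/-- A class `C` of finitely (recursively) presented groups in `B` contains the free objects of `B`
on all finite alphabets. For `C = B.FinPres` (`C = B.RecPres`) this says that `C` is a variety of
finitely (recursively) presented groups. -/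
def GroupVariety.HasFreeObjects (B : GroupVariety) (C : ∀ (G : Type) [Group G], Prop) : Prop :=
  ∀ n : ℕ, C (B.FreeObject (Fin n))

/-- The presentations, in the form `P`, of the groups in the class `C`. -/
def presentationsOf (P : Type) [PresentationData P] (C : ∀ (G : Type) [Group G], Prop) : Set P :=
  {p | Valid p ∧ C (Grp p)}

/-! ### Algorithms -/

/-- There is an algorithm that, for every input `a` with `promise a`, halts with an output `b`
such that `R a b`. -/
def Computes {α β : Type} [Primcodable α] [Primcodable β]
    (promise : α → Prop) (R : α → β → Prop) : Prop :=
  ∃ f : α →. β, Partrec f ∧ ∀ a, promise a → ∃ b ∈ f a, R a b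

/-- There is an algorithm that, for every input `a` with `promise a`, halts and tells whether
`Q a` holds. -/
def Decides {α : Type} [Primcodable α] (promise : α → Prop) (Q : α → Prop) : Prop :=
  Computes promise fun a (b : Bool) => b = true ↔ Q a

section Problems

variable {P : Type} [PresentationData P]

/-- An instance `(Σ, K, g, h)` of the PCP: a presentation of `K`, and the list of the pairs
`(g(a), h(a))` of words over the generators of `K`, where `a` runs through the alphabet `Σ`, which
is `Fin k` for `k` the length of the list. -/
abbrev PCPInput (P : Type) : Type := P × List (Word × Word)

/-- Instances of the PCP where the presentation of `K` is in the set `D`. -/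
def PCPInput.IsInstance (D : Set P) (I : PCPInput P) : Prop :=
  I.1 ∈ D ∧ ∀ u ∈ I.2, u.1.On (rank I.1) ∧ u.2.On (rank I.1)

/-- The homomorphism `g : F(Σ) → K`. -/
def PCPInput.g (I : PCPInput P) : FreeGroup (Fin I.2.length) →* Grp I.1 :=
  FreeGroup.lift fun a => value I.1 (I.2.get a).1

/-- The homomorphism `h : F(Σ) → K`. -/
def PCPInput.h (I : PCPInput P) : FreeGroup (Fin I.2.length) →* Grp I.1 :=
  FreeGroup.lift fun a => value I.1 (I.2.get a).2

/-- There is an algorithm with input an instance `(Σ, K, g, h)` of the PCP, `K` given by a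
presentation in `D`, and output a finite set `S` of words over `Σ` such that
`Eq(g, h) = ⟨S, laws of B⟩`. -/
def EqualiserComputable [Primcodable P] (B : GroupVariety) (D : Set P) : Prop :=
  Computes (PCPInput.IsInstance D) fun (I : PCPInput P) (S : List Word) =>
    (∀ w ∈ S, w.On I.2.length) ∧
    I.g.eqLocus I.h =
      Subgroup.closure {x | ∃ w ∈ S, x = w.toFree I.2.length} ⊔ B.lawSubgroup (Fin I.2.length)

/-- There is an algorithm with input a presentation of a group `K` in `D`, finite lists of
generators of two subgroups `A`, `B` of `K`, and `x ∈ K`, which decides whether `x ∈ AB`. -/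
def ProductMembershipDecidable [Primcodable P] (D : Set P) : Prop :=
  Decides
    (fun I : P × List Word × List Word × Word =>
      match I with
      | (p, A, B, x) => p ∈ D ∧ (∀ w ∈ A, w.On (rank p)) ∧ (∀ w ∈ B, w.On (rank p)) ∧
          x.On (rank p))
    (fun I => match I with
      | (p, A, B, x) => value p x ∈
          (Subgroup.closure {y | ∃ w ∈ A, y = value p w} : Set (Grp p)) *
          (Subgroup.closure {y | ∃ w ∈ B, y = value p w} : Set (Grp p)))

/-- The NPCP is decidable for instances `(Σ, K, g, h, u₁, u₂, v₁, v₂)`, `K` given by a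
presentation in `D`: there is an algorithm which decides whether `u₁ g(x) u₂ = v₁ h(x) v₂` for
some `x ≠ 1` in `F(Σ)`. -/
def NPCPDecidable [Primcodable P] (D : Set P) : Prop :=
  Decides
    (fun J : PCPInput P × Word × Word × Word × Word =>
      match J with
      | (I, u₁, u₂, v₁, v₂) => I.IsInstance D ∧ u₁.On (rank I.1) ∧ u₂.On (rank I.1) ∧
          v₁.On (rank I.1) ∧ v₂.On (rank I.1))
    (fun J => match J with
      | (I, u₁, u₂, v₁, v₂) => ∃ x : FreeGroup (Fin I.2.length), x ≠ 1 ∧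
          value I.1 u₁ * I.g x * value I.1 u₂ = value I.1 v₁ * I.h x * value I.1 v₂)

end Problems

/-!
Why the theorem holds. Put `c = v₁⁻¹u₁u₂v₂⁻¹`, and replace `g` by its conjugate by `v₁⁻¹u₁`: the
equation `u₁g(x)u₂ = v₁h(x)v₂` becomes `g(x)c = h(x)` (`exists_solution_iff_conj`). Whether `c = 1`
in `K` is decided as membership of `c` in the product of two trivial subgroups.

If `c ≠ 1`, then `x = 1` is not a solution, so only solvability matters. A solution exists iff
`(1, c)` lies in the product of the diagonal of `K × K` and of the subgroup generated by the pairs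
`(g(a), h(a))` for letters `a` (`exists_mul_eq_iff_mem_mul`). This is a membership problem in
`K × K`, whose presentation is computed from that of `K` and again belongs to the class
(`PresentsSquare.exists_hom`, `RecPresentation.exists_square`, `FinPresentation.primrec_square`).
It is here that even the non-uniform version uses the membership hypothesis for another group.

If `c = 1`, the nontrivial solutions are the nontrivial elements of the equaliser, which is
generated by a computable finite set `S` and the laws. On two letters or more the laws are
nontrivial: the free group of rank two contains free groups of all finite ranks, free groups of
arbitrary rank embed in products of free groups of finite rank, and so
a variety that contains the free group of rank two contains all
groups (`GroupVariety.lawSubgroup_ne_bot`). On one letter a single bit that depends only on the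
variety records whether there are laws, and `S` is inspected through exponent sums
(`closure_sup_lawSubgroup_ne_bot_iff`).
-/

/-! ### Free groups in a proper variety -/

namespace GroupVariety

theorem mem_of_injective (B : GroupVariety) {G H : Type} [Group G] [Group H] (f : G →* H)
    (hf : Function.Injective f) (h : B.Mem H) : B.Mem G :=
  B.image (MonoidHom.ofInjective hf).symm.toMonoidHom (MonoidHom.ofInjective hf).symm.surjective
    (B.subgroup f.range h)

theorem mem_prod (B : GroupVariety) {G : Type} [Group G] (h : B.Mem G) : B.Mem (G × G) := by
  let f : (Bool → G) →* G × G := (Pi.evalMonoidHom _ true).prod (Pi.evalMonoidHom _ false)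
  refine B.image f (fun x => ⟨fun b => if b then x.1 else x.2, by simp [f]⟩)
    (B.pi (fun _ : Bool => G) fun _ => h)

end GroupVariety

/-- The action of `ℤ` on the free group on `ℤ` by shifts: `n` sends the letter `i` to `i + n`. -/
def FreeGroup.shiftAut : Multiplicative ℤ →* MulAut (FreeGroup ℤ) where
  toFun n := FreeGroup.freeGroupCongr (Equiv.addRight n.toAdd)
  map_one' := by ext; simp
  map_mul' m n := by
    ext x
    induction x using FreeGroup.induction_on <;> simp_all [add_comm, add_left_comm]

/-- The free group on two letters `a, t` contains a free group of countable rank, freely generated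
by the conjugates `tⁱ a t⁻ⁱ`: mapping `a` to a letter and `t` to the shift in the semidirect product
of the free group on `ℤ` with `ℤ` separates the reduced words in these conjugates. -/
theorem FreeGroup.exists_injective_bool :
    ∃ f : FreeGroup ℤ →* FreeGroup Bool, Function.Injective f := by
  let f : FreeGroup ℤ →* FreeGroup Bool :=
    FreeGroup.lift fun i => FreeGroup.of true ^ i * FreeGroup.of false * (FreeGroup.of true ^ i)⁻¹
  let φ : FreeGroup Bool →* FreeGroup ℤ ⋊[FreeGroup.shiftAut] Multiplicative ℤ :=
    FreeGroup.lift fun b =>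
      if b then SemidirectProduct.inr (Multiplicative.ofAdd 1)
      else SemidirectProduct.inl (FreeGroup.of 0)
  refine ⟨f, fun x y hxy => ?_⟩
  have key : φ.comp f = SemidirectProduct.inl := by
    ext1 i
    have h1 : (SemidirectProduct.inr (Multiplicative.ofAdd (1 : ℤ)) ^ i :
        FreeGroup ℤ ⋊[FreeGroup.shiftAut] Multiplicative ℤ)
        = SemidirectProduct.inr (Multiplicative.ofAdd i) := by
      rw [← map_zpow, ← ofAdd_zsmul]; simp
    simp only [f, φ, MonoidHom.comp_apply, FreeGroup.lift_apply_of, _root_.map_mul, _root_.map_inv,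
      map_zpow, h1, if_true, Bool.false_eq_true, if_false]
    rw [← _root_.map_inv, ← SemidirectProduct.inl_aut]
    simp [FreeGroup.shiftAut]
  have h2 := congrArg φ hxy
  rw [← MonoidHom.comp_apply, ← MonoidHom.comp_apply, key] at h2
  exact SemidirectProduct.inl_injective h2

namespace GroupVariety

/-- A nontrivial element of a free group survives in the free group on the finitely many letters
that occur in it, so every free group embeds in a product of free groups of finite rank. -/
theorem mem_freeGroup (B : GroupVariety) (h : B.Mem (FreeGroup ℤ)) (X : Type) :
    B.Mem (FreeGroup X) := by
  classical
  have hfin : ∀ s : Finset X, B.Mem (FreeGroup s) := fun s => by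
    obtain ⟨e, he⟩ := exists_injective_nat s
    exact B.mem_of_injective (FreeGroup.map fun i => (e i : ℤ))
      (FreeGroup.map_injective (Nat.cast_injective.comp he)) h
  let π (s : Finset X) : FreeGroup X →* FreeGroup s :=
    FreeGroup.lift fun x => if hx : x ∈ s then FreeGroup.of ⟨x, hx⟩ else 1
  let ι (s : Finset X) : FreeGroup s →* FreeGroup X := FreeGroup.map Subtype.val
  have key : ∀ x : FreeGroup X, ∃ s₀ : Finset X, ∀ s, s₀ ⊆ s → ι s (π s x) = x := by
    intro x
    induction x using FreeGroup.induction_on with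
    | C1 => exact ⟨∅, fun s _ => by simp⟩
    | of x =>
      refine ⟨{x}, fun s hs => ?_⟩
      have : x ∈ s := hs (by simp)
      simp [π, ι, this]
    | inv_of x ih =>
      obtain ⟨s₀, h₀⟩ := ih
      exact ⟨s₀, fun s hs => by rw [map_inv, map_inv]; exact congrArg _ (h₀ s hs)⟩
    | mul x y ihx ihy =>
      obtain ⟨s, hs⟩ := ihx
      obtain ⟨t, ht⟩ := ihy
      refine ⟨s ∪ t, fun r hr => ?_⟩
      rw [map_mul, map_mul, hs r (Finset.union_subset_left hr),
        ht r (Finset.union_subset_right hr)]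
  refine B.mem_of_injective (MonoidHom.pi π) ?_ (B.pi (fun s : Finset X => FreeGroup s) hfin)
  rw [injective_iff_map_eq_one]
  intro x hx
  obtain ⟨s, hs⟩ := key x
  rw [← hs s le_rfl, show π s x = 1 from congrFun hx s, map_one]

/-- If the free group of rank `n ≥ 2` had no laws, it would lie in the variety, and with it all
free groups and their quotients. -/
theorem lawSubgroup_ne_bot (B : GroupVariety) (hB : B.IsProper) {n : ℕ} (hn : 2 ≤ n) :
    B.lawSubgroup (Fin n) ≠ ⊥ := by
  intro hbot
  refine hB fun G _ => ?_
  have hmem : B.Mem (FreeGroup (Fin n)) := by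
    refine B.mem_of_injective (QuotientGroup.mk' (B.lawSubgroup (Fin n))) ?_
      (B.mem_quotient_lawSubgroup (Fin n))
    rw [← MonoidHom.ker_eq_bot_iff, QuotientGroup.ker_mk', hbot]
  obtain ⟨f, hf⟩ := FreeGroup.exists_injective_bool
  obtain ⟨e⟩ : Nonempty (Bool ↪ Fin n) :=
    Function.Embedding.nonempty_of_card_le (by simpa using hn)
  have hZ : B.Mem (FreeGroup ℤ) := B.mem_of_injective ((FreeGroup.map e).comp f)
    ((FreeGroup.map_injective e.injective).comp hf) hmem
  exact B.image (FreeGroup.lift (id : G → G)) (fun x => ⟨FreeGroup.of x, by simp⟩)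
    (B.mem_freeGroup hZ G)

end GroupVariety

/-! ### Words -/

namespace Word

/-- The formal inverse of a word. -/
def inv (w : Word) : Word := (w.map fun l => (l.1, !l.2)).reverse

/-- The word obtained by renaming each letter `xᵢ` to `xₙ₊ᵢ`. -/
def shift (n : ℕ) (w : Word) : Word := w.map fun l => (n + l.1, l.2)

theorem On.append {n : ℕ} {u v : Word} (hu : u.On n) (hv : v.On n) : On n (u ++ v) := by
  intro l hl
  rcases List.mem_append.1 hl with h | h
  exacts [hu l h, hv l h]

theorem On.inv {n : ℕ} {u : Word} (hu : u.On n) : u.inv.On n := by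
  intro l hl
  simp only [Word.inv, List.mem_reverse, List.mem_map] at hl
  obtain ⟨l', h, rfl⟩ := hl
  exact hu l' h

theorem On.mono {m n : ℕ} (hmn : m ≤ n) {u : Word} (hu : u.On m) : u.On n :=
  fun l hl => (hu l hl).trans_le hmn

theorem On.shift {m : ℕ} (n : ℕ) {u : Word} (hu : u.On m) : (u.shift n).On (n + m) := by
  intro l hl
  obtain ⟨l', h, rfl⟩ := List.mem_map.1 hl
  have := hu l' h
  simpa

theorem on_nil (n : ℕ) : On n [] := by simp [On]

theorem on_singleton {n i : ℕ} (h : i < n) (b : Bool) : On n [(i, b)] := by simpa [On]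

section eval

variable {G : Type} [Group G] {n : ℕ} (x : Fin n → G)

@[simp] theorem eval_nil : eval x [] = 1 := rfl

@[simp] theorem eval_append (u v : Word) : eval x (u ++ v) = eval x u * eval x v := by
  simp [eval]

theorem eval_cons (l : ℕ × Bool) (w : Word) : eval x (l :: w) = eval x [l] * eval x w := by
  simp [eval]

@[simp] theorem eval_inv (w : Word) : eval x w.inv = (eval x w)⁻¹ := by
  induction w with
  | nil => simp [Word.inv]
  | cons l w ih =>
    have : inv (l :: w) = inv w ++ [(l.1, !l.2)] := by simp [Word.inv]
    rw [this, eval_append, ih, eval_cons x l w, mul_inv_rev]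
    congr 1
    by_cases h : l.1 < n <;> cases hb : l.2 <;> simp [eval, h, hb]

theorem map_eval {H : Type} [Group H] (f : G →* H) (w : Word) :
    f (eval x w) = eval (fun i => f (x i)) w := by
  rw [eval, eval, map_list_prod, List.map_map]
  congr 2
  funext l
  by_cases h : l.1 < n <;> cases hb : l.2 <;> simp [h, hb]

theorem lift_toFree (w : Word) : FreeGroup.lift x (w.toFree n) = eval x w := by
  rw [toFree, map_eval]
  simp

/-- Evaluation only depends on the values of the letters that occur. -/
theorem eval_congr {m : ℕ} {y : Fin m → G} {w : Word} (f : ℕ → ℕ)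
    (h : ∀ i : Fin n, ∃ hi : f i < m, y ⟨f i, hi⟩ = x i) (hw : w.On n) :
    eval y (w.map fun l => (f l.1, l.2)) = eval x w := by
  induction w with
  | nil => rfl
  | cons l w ih =>
    rw [List.map_cons, eval_cons, eval_cons x, ih fun l' h' => hw l' (List.mem_cons_of_mem _ h')]
    congr 1
    have hl : l.1 < n := hw l List.mem_cons_self
    obtain ⟨hi, hy⟩ := h ⟨l.1, hl⟩
    simp only at hi hy
    simp [eval, hl, hi, hy]

end eval

end Word

/-! ### Presentations of direct squares -/

namespace Word

/-- The commutators `[xᵢ, xₙ₊ⱼ]` for `i, j < n`. -/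
def crossCommutators (n : ℕ) : List Word :=
  (List.range n).flatMap fun i => (List.range n).map fun j =>
    [(i, true), (n + j, true), (i, false), (n + j, false)]

theorem mem_crossCommutators {n : ℕ} {w : Word} : w ∈ crossCommutators n ↔
    ∃ i < n, ∃ j < n, w = [(i, true), (n + j, true), (i, false), (n + j, false)] := by
  simp [crossCommutators, eq_comm]

theorem on_of_mem_crossCommutators {n : ℕ} {w : Word} (hw : w ∈ crossCommutators n) :
    w.On (n + n) := by
  obtain ⟨i, hi, j, hj, rfl⟩ := mem_crossCommutators.1 hw
  intro l hl
  simp only [List.mem_cons, List.not_mem_nil, or_false] at hl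
  rcases hl with rfl | rfl | rfl | rfl <;> simp only <;> omega

/-- The generators `xᵢ xₙ₊ᵢ` of the diagonal in the square of a group with `n` generators. -/
def diagonal (n : ℕ) : List Word := (List.range n).map fun i => [(i, true), (n + i, true)]

theorem on_of_mem_diagonal {n : ℕ} {w : Word} (hw : w ∈ diagonal n) : w.On (n + n) := by
  obtain ⟨i, hi, rfl⟩ := List.mem_map.1 hw
  have := List.mem_range.1 hi
  intro l hl
  simp only [List.mem_cons, List.not_mem_nil, or_false] at hl
  rcases hl with rfl | rfl <;> simp only <;> omega

end Word

section Square

variable {P : Type} [PresentationData P]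

/-- The presentation `q` is the standard presentation of the direct square of the group presented
by `p`: with `n` the rank of `p`, the generators `x₀, …, xₙ₋₁` stand for the first factor and
`xₙ, …, x₂ₙ₋₁` for the second one. -/
structure PresentsSquare (p q : P) : Prop where
  rank_eq : rank q = rank p + rank p
  relators_eq : relators q =
    relators p ∪ Word.shift (rank p) '' relators p ∪ {w | w ∈ Word.crossCommutators (rank p)}

theorem value_of_mem_relators {p : P} {w : Word} (hw : w ∈ relators p) : value p w = 1 := by
  have h : PresentedGroup.mk (Word.toFree (rank p) '' relators p) (w.toFree (rank p)) = 1 :=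
    PresentedGroup.one_of_mem ⟨w, hw, rfl⟩
  rw [Word.toFree, Word.map_eval] at h
  exact h

theorem commute_of_commute_of {p : P} {G : Type} [Group G] (f : Grp p →* G) {g : G}
    (h : ∀ i, Commute (f (.of i)) g) (a : Grp p) : Commute (f a) g := by
  have ha := PresentedGroup.generated_by _ ((Subgroup.centralizer {g}).comap f)
    (fun i => Subgroup.mem_centralizer_singleton_iff.2 (h i).eq) a
  exact Subgroup.mem_centralizer_singleton_iff.1 (Subgroup.mem_comap.1 ha)

/-- The group presented by `q` embeds in the square; this is onto as well, but only injectivity is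
needed to transport subgroup membership problems. -/
theorem PresentsSquare.exists_hom {p q : P} (hq : PresentsSquare p q)
    (hp : ∀ w ∈ relators p, w.On (rank p)) :
    ∃ φ : Grp q →* Grp p × Grp p, Function.Injective φ ∧ ∀ u v : Word, u.On (rank p) →
      v.On (rank p) → φ (value q (u ++ v.shift (rank p))) = (value p u, value p v) := by
  have hr := hq.rank_eq
  set n := rank p with hn
  let f (j : Fin (rank q)) : Grp p × Grp p :=
    if h : (j : ℕ) < n then (PresentedGroup.of ⟨j, h⟩, 1)
    else (1, PresentedGroup.of ⟨j - n, by omega⟩)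
  have hf₁ : ∀ w : Word, w.On n → w.eval f = (value p w, 1) := fun w hw => by
    have h := Word.eval_congr (y := f)
      (fun i : Fin n => ((PresentedGroup.of i : Grp p), (1 : Grp p))) id
      (fun i => ⟨show (i : ℕ) < rank q by omega, by simp [f]⟩) hw
    simp only [id, Prod.mk.eta, List.map_id'] at h
    rw [h, ← MonoidHom.inl_apply, value, Word.map_eval]
    rfl
  have hf₂ : ∀ w : Word, w.On n → (w.shift n).eval f = (1, value p w) := fun w hw => by
    have h := Word.eval_congr (y := f)
      (fun i : Fin n => ((1 : Grp p), (PresentedGroup.of i : Grp p))) (fun i => n + i)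
      (fun i => ⟨show n + (i : ℕ) < rank q by omega, by simp [f]⟩) hw
    rw [Word.shift, h, ← MonoidHom.inr_apply, value, Word.map_eval]
    rfl
  have hfr : ∀ r ∈ Word.toFree (rank q) '' relators q, FreeGroup.lift f r = 1 := by
    rintro _ ⟨w, hw, rfl⟩
    rw [Word.lift_toFree]
    rw [hq.relators_eq] at hw
    rcases hw with (hw | ⟨w, hw, rfl⟩) | hw
    · rw [hf₁ w (hp w hw), value_of_mem_relators hw]; rfl
    · rw [hf₂ w (hp w hw), value_of_mem_relators hw]; rfl
    · obtain ⟨i, hi, j, hj, rfl⟩ := Word.mem_crossCommutators.1 hw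
      have h₁ (b : Bool) := hf₁ [(i, b)] (Word.on_singleton hi b)
      have h₂ (b : Bool) := hf₂ [(j, b)] (Word.on_singleton hj b)
      simp only [Word.shift, List.map_cons, List.map_nil] at h₂
      have e : ∀ (k : ℕ) (hk : k < n), value p [(k, false)] = (value p [(k, true)])⁻¹ :=
        fun k hk => by simp [value, Word.eval, ← hn, hk]
      rw [Word.eval_cons, Word.eval_cons f (n + j, true), Word.eval_cons f (i, false), h₁, h₁, h₂,
        h₂, e i hi, e j hj]
      simp
  let φ : Grp q →* Grp p × Grp p := PresentedGroup.toGroup hfr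
  have hφ : ∀ w, φ (value q w) = w.eval f := fun w => by
    rw [value, Word.map_eval]
    simp [φ]
  let y₁ (i : Fin n) : Grp q := PresentedGroup.of ⟨i, by omega⟩
  let y₂ (i : Fin n) : Grp q := PresentedGroup.of ⟨n + i, by omega⟩
  have hy₁ : ∀ w : Word, w.On n → w.eval y₁ = value q w := fun w hw => by
    have h := Word.eval_congr (y := fun i : Fin (rank q) => (PresentedGroup.of i : Grp q)) y₁ id
      (fun i => ⟨show (i : ℕ) < rank q by omega, rfl⟩) hw
    simp only [id, Prod.mk.eta, List.map_id'] at h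
    exact h.symm
  have hy₂ : ∀ w : Word, w.On n → w.eval y₂ = value q (w.shift n) := fun w hw =>
    (Word.eval_congr (y := fun i : Fin (rank q) => (PresentedGroup.of i : Grp q)) y₂
      (fun i => n + i) (fun i => ⟨show n + (i : ℕ) < rank q by omega, rfl⟩) hw).symm
  have hr₁ : ∀ r ∈ Word.toFree n '' relators p, FreeGroup.lift y₁ r = 1 := by
    rintro _ ⟨w, hw, rfl⟩
    rw [Word.lift_toFree, hy₁ w (hp w hw)]
    exact value_of_mem_relators (hq.relators_eq ▸ Or.inl (Or.inl hw))
  have hr₂ : ∀ r ∈ Word.toFree n '' relators p, FreeGroup.lift y₂ r = 1 := by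
    rintro _ ⟨w, hw, rfl⟩
    rw [Word.lift_toFree, hy₂ w (hp w hw)]
    exact value_of_mem_relators (hq.relators_eq ▸ Or.inl (Or.inr ⟨w, hw, rfl⟩))
  let ι₁ : Grp p →* Grp q := PresentedGroup.toGroup hr₁
  let ι₂ : Grp p →* Grp q := PresentedGroup.toGroup hr₂
  have hcomm : ∀ i j, Commute (y₁ i) (y₂ j) := fun i j => by
    have h := value_of_mem_relators (p := q)
      (w := [(i, true), (n + j, true), (i, false), (n + j, false)])
      (hq.relators_eq ▸ Or.inr (Word.mem_crossCommutators.2 ⟨i, i.2, j, j.2, rfl⟩))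
    have hi : (i : ℕ) < rank q := by omega
    have hj : n + (j : ℕ) < rank q := by omega
    simp only [value, Word.eval, List.map_cons, List.map_nil, hi, hj, dif_pos, if_true,
      Bool.false_eq_true, if_false, List.prod_cons, List.prod_nil, mul_one] at h
    rw [← mul_assoc, ← mul_assoc] at h
    exact commutatorElement_eq_one_iff_commute.1 h
  have hι₁ : ∀ i, ι₁ (.of i) = y₁ i := fun i => PresentedGroup.toGroup.of hr₁
  have hι₂ : ∀ i, ι₂ (.of i) = y₂ i := fun i => PresentedGroup.toGroup.of hr₂
  have hcomm' : ∀ a b, Commute (ι₁ a) (ι₂ b) := fun a b =>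
    commute_of_commute_of ι₁ (fun i => (commute_of_commute_of ι₂ (fun j => by
      rw [hι₁, hι₂]; exact (hcomm i j).symm) b).symm) a
  have hinv : (ι₁.noncommCoprod ι₂ hcomm').comp φ = MonoidHom.id _ := by
    refine PresentedGroup.ext fun j => ?_
    have hj : φ (.of j) = f j := PresentedGroup.toGroup.of hfr
    rw [MonoidHom.comp_apply, hj, MonoidHom.id_apply]
    by_cases h : (j : ℕ) < n
    · simp [f, h, hι₁, y₁]
    · have : n + ((j : ℕ) - n) = j := by omega
      simp [f, h, hι₂, y₂, this]
  refine ⟨φ, Function.LeftInverse.injective (g := ι₁.noncommCoprod ι₂ hcomm')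
    (fun x => DFunLike.congr_fun hinv x), fun u v hu hv => ?_⟩
  rw [hφ, Word.eval_append, hf₁ u hu, hf₂ v hv]
  simp

end Square

/-! ### Nontriviality of the equaliser -/

namespace Word

/-- The condition that the exponent sum of a word vanishes. -/
def Balanced (w : Word) : Prop :=
  (w.filter fun l => l.2 = true).length = (w.filter fun l => l.2 = false).length

theorem eval_const {G : Type} [Group G] (g : G) {n : ℕ} {w : Word} (hw : w.On n) :
    w.eval (fun _ : Fin n => g) = g ^
      (((w.filter fun l => l.2 = true).length : ℤ) - (w.filter fun l => l.2 = false).length) := by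
  induction w with
  | nil => simp
  | cons l w ih =>
    rw [eval_cons, ih fun l' h' => hw l' (List.mem_cons_of_mem _ h')]
    have hl : l.1 < n := hw l List.mem_cons_self
    cases hb : l.2
    · simp only [eval, hl, hb, List.map_cons, List.map_nil, dif_pos, Bool.false_eq_true, if_false,
        List.prod_cons, List.prod_nil, mul_one, ← zpow_neg_one g, ← zpow_add]
      simp [hb]
      congr 1; ring
    · simp only [eval, hl, hb, List.map_cons, List.map_nil, dif_pos, if_true, List.prod_cons,
        List.prod_nil, mul_one, ← zpow_one_add]
      simp [hb]
      congr 1; ring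

theorem toFree_ne_one {n : ℕ} {w : Word} (hw : w.On n) (h : ¬ w.Balanced) : w.toFree n ≠ 1 := by
  intro h1
  have h2 := congrArg (FreeGroup.lift fun _ : Fin n => Multiplicative.ofAdd (1 : ℤ)) h1
  rw [lift_toFree, eval_const _ hw, map_one (FreeGroup.lift _), ← ofAdd_zsmul, ofAdd_eq_one] at h2
  apply h
  simp only [smul_eq_mul, mul_one] at h2
  unfold Balanced
  omega

theorem toFree_eq_one_of_le_one {n : ℕ} (hn : n ≤ 1) {w : Word} (hw : w.On n) (h : w.Balanced) :
    w.toFree n = 1 := by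
  interval_cases n
  · exact Subsingleton.elim _ _
  · have : (FreeGroup.of : Fin 1 → FreeGroup (Fin 1)) = fun _ => FreeGroup.of 0 :=
      funext fun i => by rw [Subsingleton.elim i 0]
    rw [toFree, this, eval_const _ hw, h, sub_self, zpow_zero]

end Word

/-- In rank at least two the laws suffice to make the subgroup nontrivial, since the variety is
proper. In rank at most one the free group is cyclic, and exponent sums tell which words are
trivial. -/
theorem closure_sup_lawSubgroup_ne_bot_iff (B : GroupVariety) (hB : B.IsProper) {k : ℕ}
    {S : List Word} (hS : ∀ w ∈ S, w.On k) :
    Subgroup.closure {x | ∃ w ∈ S, x = w.toFree k} ⊔ B.lawSubgroup (Fin k) ≠ ⊥ ↔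
      2 ≤ k ∨ (k = 1 ∧ B.lawSubgroup (Fin 1) ≠ ⊥) ∨ ∃ w ∈ S, ¬ w.Balanced := by
  rw [ne_eq, sup_eq_bot_iff]
  constructor
  · contrapose!
    rintro ⟨hk, hlaw, hbal⟩
    constructor
    · rw [Subgroup.closure_eq_bot_iff]
      rintro _ ⟨w, hw, rfl⟩
      exact Word.toFree_eq_one_of_le_one (by omega) (hS w hw) (hbal w hw)
    · obtain rfl | rfl : k = 0 ∨ k = 1 := by omega
      · exact Subsingleton.elim _ _
      · exact hlaw rfl
  · rintro (hk | ⟨rfl, hlaw⟩ | ⟨w, hw, hbal⟩) ⟨h1, h2⟩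
    · exact B.lawSubgroup_ne_bot hB hk h2
    · exact hlaw h2
    · rw [Subgroup.closure_eq_bot_iff] at h1
      exact Word.toFree_ne_one (hS w hw) hbal (h1 ⟨w, hw, rfl⟩)

/-! ### Normal form of the equation -/

section Equation

variable {P : Type} [PresentationData P]

/-- The instance in which `g` is replaced by its conjugate by the value of the word `a`. -/
def PCPInput.conj (I : PCPInput P) (a : Word) : PCPInput P :=
  (I.1, I.2.map fun u => (a ++ u.1 ++ a.inv, u.2))

theorem value_append (p : P) (u v : Word) : value p (u ++ v) = value p u * value p v :=
  Word.eval_append _ u v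

theorem value_inv (p : P) (w : Word) : value p w.inv = (value p w)⁻¹ := Word.eval_inv _ w

theorem PCPInput.conj_isInstance {D : Set P} {I : PCPInput P} (hI : I.IsInstance D) {a : Word}
    (ha : a.On (rank I.1)) : (I.conj a).IsInstance D := by
  refine ⟨hI.1, fun u hu => ?_⟩
  obtain ⟨u', hu', rfl⟩ := List.mem_map.1 hu
  exact ⟨(ha.append (hI.2 u' hu').1).append ha.inv, (hI.2 u' hu').2⟩

/-- The alphabets of `I` and `I.conj a` have the same size, and are identified by
`finCongr`. -/
theorem PCPInput.exists_equiv_conj (I : PCPInput P) (a : Word) :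
    ∃ e : FreeGroup (Fin I.2.length) ≃* FreeGroup (Fin (I.conj a).2.length), ∀ x,
      (I.conj a).g (e x) = value I.1 a * I.g x * (value I.1 a)⁻¹ ∧ (I.conj a).h (e x) = I.h x := by
  have hlen : I.2.length = (I.conj a).2.length := by simp [conj]
  refine ⟨FreeGroup.freeGroupCongr (finCongr hlen), fun x => ⟨?_, ?_⟩⟩
  · have : (I.conj a).g.comp (FreeGroup.freeGroupCongr (finCongr hlen)).toMonoidHom =
        (MulAut.conj (value I.1 a)).toMonoidHom.comp I.g := by
      ext1 i
      change (I.conj a).g (FreeGroup.map _ (FreeGroup.of i)) =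
        value I.1 a * I.g (FreeGroup.of i) * (value I.1 a)⁻¹
      simp only [PCPInput.g, FreeGroup.map.of, FreeGroup.lift_apply_of, ← value_append, ← value_inv]
      simp [PCPInput.conj]
      rfl
    exact DFunLike.congr_fun this x
  · have : (I.conj a).h.comp (FreeGroup.freeGroupCongr (finCongr hlen)).toMonoidHom = I.h := by
      ext1 i
      change (I.conj a).h (FreeGroup.map _ (FreeGroup.of i)) = I.h (FreeGroup.of i)
      simp only [PCPInput.h, FreeGroup.map.of, FreeGroup.lift_apply_of]
      simp [PCPInput.conj]
      rfl
    exact DFunLike.congr_fun this x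

/-- The general equation `u₁ g(x) u₂ = v₁ h(x) v₂` amounts to `g'(x) c = h(x)`, where `g'` is the
conjugate of `g` by `a = v₁⁻¹ u₁` and `c = v₁⁻¹ u₁ u₂ v₂⁻¹`. -/
theorem exists_solution_iff_conj (I : PCPInput P) (u₁ u₂ v₁ v₂ : Word) :
    (∃ x : FreeGroup (Fin I.2.length), x ≠ 1 ∧
      value I.1 u₁ * I.g x * value I.1 u₂ = value I.1 v₁ * I.h x * value I.1 v₂) ↔
    ∃ x : FreeGroup (Fin (I.conj (v₁.inv ++ u₁)).2.length), x ≠ 1 ∧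
      (I.conj (v₁.inv ++ u₁)).g x *
          value (I.conj (v₁.inv ++ u₁)).1 (v₁.inv ++ u₁ ++ (u₂ ++ v₂.inv)) =
        (I.conj (v₁.inv ++ u₁)).h x := by
  obtain ⟨e, he⟩ := I.exists_equiv_conj (v₁.inv ++ u₁)
  rw [e.surjective.exists]
  refine exists_congr fun x => and_congr (by simp) ?_
  rw [(he x).1, (he x).2]
  change _ ↔ value I.1 _ * I.g x * _ * value I.1 _ = I.h x
  simp only [value_append, value_inv]
  constructor <;> intro h
  · have : I.h x = (value I.1 v₁)⁻¹ * (value I.1 u₁ * I.g x * value I.1 u₂) *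
        (value I.1 v₂)⁻¹ := by rw [h]; group
    rw [this]; group
  · rw [← h]; group

/-- Subgroup products detect the equation: `g(x) c = h(x)` says that the element `(1, c)` of the
direct square is the product of `(g(x), g(x))⁻¹` and `(g(x), h(x))`. -/
theorem exists_mul_eq_iff_mem_mul {F K : Type} [Group F] [Group K] (g h : F →* K) (c : K) :
    (∃ x, g x * c = h x) ↔ ((1, c) : K × K) ∈
      (((MonoidHom.id K).prod (MonoidHom.id K)).range : Set (K × K)) *
        ((g.prod h).range : Set (K × K)) := by
  rw [Set.mem_mul]
  constructor
  · rintro ⟨x, hx⟩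
    refine ⟨_, ⟨(g x)⁻¹, rfl⟩, _, ⟨x, rfl⟩, ?_⟩
    simp [← hx]
  · rintro ⟨_, ⟨k, rfl⟩, _, ⟨x, rfl⟩, hx⟩
    simp only [MonoidHom.prod_apply, MonoidHom.id_apply, Prod.mk_mul_mk, Prod.mk.injEq] at hx
    refine ⟨x, ?_⟩
    rw [← hx.2, ← mul_assoc, mul_eq_one_iff_eq_inv.1 hx.1]
    simp

/-- The generators `(g(a), h(a))` of the subgroup `{(g(x), h(x))}` of the direct square. -/
def PCPInput.graph (I : PCPInput P) : List Word :=
  I.2.map fun u => u.1 ++ u.2.shift (rank I.1)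

theorem PCPInput.on_of_mem_graph {D : Set P} {I : PCPInput P} (hI : I.IsInstance D) {w : Word}
    (hw : w ∈ I.graph) : w.On (rank I.1 + rank I.1) := by
  obtain ⟨u, hu, rfl⟩ := List.mem_map.1 hw
  exact ((hI.2 u hu).1.mono (by omega)).append ((hI.2 u hu).2.shift _)

theorem PresentsSquare.value_mem_iff {D : Set P} {I : PCPInput P} (hI : I.IsInstance D) {q : P}
    (hq : PresentsSquare I.1 q) (hrel : ∀ w ∈ relators I.1, w.On (rank I.1)) {c : Word}
    (hc : c.On (rank I.1)) :
    value q (c.shift (rank I.1)) ∈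
        (Subgroup.closure {y | ∃ w ∈ Word.diagonal (rank I.1), y = value q w} : Set (Grp q)) *
        (Subgroup.closure {y | ∃ w ∈ I.graph, y = value q w} : Set (Grp q)) ↔
      ∃ x, I.g x * value I.1 c = I.h x := by
  obtain ⟨φ, hinj, hφ⟩ := hq.exists_hom hrel
  have hc' := hφ [] c (Word.on_nil _) hc
  rw [List.nil_append] at hc'
  have hΔ : (Subgroup.closure {y | ∃ w ∈ Word.diagonal (rank I.1), y = value q w}).map φ =
      ((MonoidHom.id (Grp I.1)).prod (MonoidHom.id (Grp I.1))).range := by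
    rw [MonoidHom.map_closure, MonoidHom.range_eq_map,
      ← PresentedGroup.closure_range_of, MonoidHom.map_closure]
    congr 1
    have key : ∀ i (hi : i < rank I.1), φ (value q [(i, true), (rank I.1 + i, true)]) =
        ((PresentedGroup.of ⟨i, hi⟩ : Grp I.1), (PresentedGroup.of ⟨i, hi⟩ : Grp I.1)) := by
      intro i hi
      have h := hφ [(i, true)] [(i, true)] (Word.on_singleton hi _) (Word.on_singleton hi _)
      have hv : value I.1 [(i, true)] = PresentedGroup.of ⟨i, hi⟩ := by
        simp [value, Word.eval, hi]
      rwa [hv] at h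
    ext y
    simp only [Set.mem_image, Set.mem_ofPred_eq, Word.diagonal, List.mem_map, List.mem_range,
      Set.mem_range]
    constructor
    · rintro ⟨_, ⟨_, ⟨i, hi, rfl⟩, rfl⟩, rfl⟩
      exact ⟨_, ⟨⟨i, hi⟩, rfl⟩, (key i hi).symm⟩
    · rintro ⟨_, ⟨i, rfl⟩, rfl⟩
      exact ⟨_, ⟨_, ⟨i, i.2, rfl⟩, rfl⟩, key i i.2⟩
  have hΓ : (Subgroup.closure {y | ∃ w ∈ I.graph, y = value q w}).map φ = (I.g.prod I.h).range := by
    rw [MonoidHom.map_closure, MonoidHom.range_eq_map, ← FreeGroup.closure_range_of,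
      MonoidHom.map_closure]
    congr 1
    ext y
    simp only [Set.mem_image, Set.mem_ofPred_eq, PCPInput.graph, List.mem_map, Set.mem_range]
    constructor
    · rintro ⟨_, ⟨_, ⟨u, hu, rfl⟩, rfl⟩, rfl⟩
      obtain ⟨i, rfl⟩ := List.mem_iff_get.1 hu
      refine ⟨_, ⟨i, rfl⟩, ?_⟩
      rw [hφ _ _ (hI.2 _ hu).1 (hI.2 _ hu).2]
      simp [PCPInput.g, PCPInput.h]
    · rintro ⟨_, ⟨i, rfl⟩, rfl⟩
      have hu := List.get_mem I.2 i
      refine ⟨_, ⟨_, ⟨_, hu, rfl⟩, rfl⟩, ?_⟩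
      rw [hφ _ _ (hI.2 _ hu).1 (hI.2 _ hu).2]
      simp [PCPInput.g, PCPInput.h]
  rw [exists_mul_eq_iff_mem_mul, ← hΔ, ← hΓ, Subgroup.coe_map, Subgroup.coe_map, ← Set.image_mul,
    ← hinj.mem_set_image, hc']
  rfl

end Equation

/-! ### Computability of the operations on words -/

namespace Word

theorem primrec_inv : Primrec Word.inv :=
  Primrec.list_reverse.comp (Primrec.list_map .id
    ((Primrec.fst.comp .snd).pair (Primrec.not.comp (Primrec.snd.comp .snd))).to₂)

theorem primrec_shift : Primrec₂ Word.shift :=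
  Primrec.list_map .snd (((Primrec.nat_add.comp (Primrec.fst.comp .fst)
    (Primrec.fst.comp .snd)).pair (Primrec.snd.comp .snd)).to₂)

theorem primrec_crossCommutators : Primrec Word.crossCommutators := by
  have hi : Primrec fun x : (ℕ × ℕ) × ℕ => x.1.2 := Primrec.snd.comp .fst
  have hj : Primrec fun x : (ℕ × ℕ) × ℕ => x.1.1 + x.2 :=
    Primrec.nat_add.comp (Primrec.fst.comp .fst) .snd
  have hcons {f : (ℕ × ℕ) × ℕ → ℕ} {b : Bool} {g : (ℕ × ℕ) × ℕ → Word} (hf : Primrec f)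
      (hg : Primrec g) : Primrec fun x => (f x, b) :: g x :=
    Primrec.list_cons.comp (hf.pair (.const b)) hg
  exact Primrec.list_flatMap Primrec.list_range (Primrec.list_map (Primrec.list_range.comp .fst)
    (hcons hi (hcons hj (hcons hi (hcons hj (.const []))))).to₂).to₂

theorem primrec_diagonal : Primrec Word.diagonal :=
  Primrec.list_map Primrec.list_range ((Primrec.list_cons.comp (Primrec.snd.pair (.const true))
    (Primrec.list_cons.comp ((Primrec.nat_add.comp .fst .snd).pair (.const true)) (.const []))).to₂)

theorem primrecPred_balanced : PrimrecPred Balanced :=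
  Primrec.eq.comp
    (Primrec.list_length.comp (Primrec.listFilter (Primrec.eq.comp .snd (.const true))))
    (Primrec.list_length.comp (Primrec.listFilter (Primrec.eq.comp .snd (.const false))))

end Word

theorem PCPInput.primrec_conj {P : Type} [Primcodable P] :
    Primrec₂ (PCPInput.conj : PCPInput P → Word → PCPInput P) := by
  have ha : Primrec fun x : (PCPInput P × Word) × (Word × Word) => x.1.2 := Primrec.snd.comp .fst
  exact (Primrec.fst.comp .fst).pair (Primrec.list_map (Primrec.snd.comp .fst)
    ((Primrec.list_append.comp (Primrec.list_append.comp ha (Primrec.fst.comp .snd))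
      (Word.primrec_inv.comp ha)).pair (Primrec.snd.comp .snd)).to₂)

section Reduction

variable {P : Type} [PresentationData P] [Primcodable P]

theorem PCPInput.primrec_graph (hrank : Primrec (rank : P → ℕ)) :
    Primrec (PCPInput.graph : PCPInput P → List Word) :=
  Primrec.list_map .snd (Primrec.list_append.comp (Primrec.fst.comp .snd)
    (Word.primrec_shift.comp (hrank.comp (Primrec.fst.comp .fst)) (Primrec.snd.comp .snd))).to₂

theorem Computes.mono {α β : Type} [Primcodable α] [Primcodable β] {p q : α → Prop}
    {R : α → β → Prop} (h : Computes q R) (hpq : ∀ a, p a → q a) : Computes p R := by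
  obtain ⟨f, hf, hfR⟩ := h
  exact ⟨f, hf, fun a ha => hfR a (hpq a ha)⟩

theorem ProductMembershipDecidable.mono {D E : Set P} (h : ProductMembershipDecidable E)
    (hDE : D ⊆ E) : ProductMembershipDecidable D :=
  Computes.mono h fun _ hI => ⟨hDE hI.1, hI.2⟩

/-- The equation `g(x) c = h(x)` is decided as follows. If `c = 1`, its nontrivial solutions are the
nontrivial elements of the equaliser, and the generators of the equaliser tell whether there are
any. If `c ≠ 1`, every solution is nontrivial, and solvability is a membership problem for a product
of subgroups of the direct square. -/
theorem npcpDecidable_of_presentsSquare (B : GroupVariety) (hB : B.IsProper) {D : Set P}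
    (hrank : Primrec (rank : P → ℕ)) (hrel : ∀ p ∈ D, ∀ w ∈ relators p, w.On (rank p))
    {sq : P → P} (hsq : Primrec sq) (hsqD : ∀ p ∈ D, PresentsSquare p (sq p))
    (hEq : EqualiserComputable B D) (hD : ProductMembershipDecidable D)
    (hDsq : ProductMembershipDecidable (sq '' D)) : NPCPDecidable D := by
  classical
  obtain ⟨e, he, heq⟩ := hEq
  obtain ⟨m, hm, hmem⟩ := hD
  obtain ⟨m', hm', hmem'⟩ := hDsq
  let α : Type := PCPInput P × Word × Word × Word × Word
  let a (J : α) : Word := J.2.2.2.1.inv ++ J.2.1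
  let c (J : α) : Word := a J ++ (J.2.2.1 ++ J.2.2.2.2.inv)
  let I (J : α) : PCPInput P := J.1.conj (a J)
  -- The triviality problem for `c` is membership in the product of two trivial subgroups
  let T₁ (J : α) : P × List Word × List Word × Word := ((I J).1, [], [], c J)
  let T₂ (J : α) : P × List Word × List Word × Word :=
    (sq (I J).1, Word.diagonal (rank (I J).1), (I J).graph, (c J).shift (rank (I J).1))
  let test (J : α) (S : List Word) : Prop := 2 ≤ (I J).2.length ∨
    ((I J).2.length = 1 ∧ B.lawSubgroup (Fin 1) ≠ ⊥) ∨ ∃ w ∈ S, ¬ w.Balanced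
  have ha : Primrec a := Primrec.list_append.comp
    (Word.primrec_inv.comp (Primrec.fst.comp (Primrec.snd.comp (Primrec.snd.comp .snd))))
    (Primrec.fst.comp .snd)
  have hc : Primrec c := Primrec.list_append.comp ha
    (Primrec.list_append.comp (Primrec.fst.comp (Primrec.snd.comp .snd))
      (Word.primrec_inv.comp (Primrec.snd.comp (Primrec.snd.comp (Primrec.snd.comp .snd)))))
  have hI : Primrec I := PCPInput.primrec_conj.comp .fst ha
  have hp : Primrec fun J => (I J).1 := Primrec.fst.comp hI
  have hn : Primrec fun J => rank (I J).1 := hrank.comp hp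
  have hT₁ : Primrec T₁ := hp.pair ((Primrec.const []).pair ((Primrec.const []).pair hc))
  have hT₂ : Primrec T₂ := (hsq.comp hp).pair ((Word.primrec_diagonal.comp hn).pair
    (((PCPInput.primrec_graph hrank).comp hI).pair (Word.primrec_shift.comp hn hc)))
  have hlen : Primrec fun x : α × List Word => (I x.1).2.length :=
    Primrec.list_length.comp (Primrec.snd.comp (hI.comp .fst))
  have htest : PrimrecRel test := by
    refine (Primrec.nat_le.comp (.const 2) hlen).or (.or (.and (Primrec.eq.comp hlen (.const 1)) ?_)
      (Word.primrecPred_balanced.not.exists_mem_list.comp .snd))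
    by_cases h : B.lawSubgroup (Fin 1) = ⊥
    · exact PrimrecPred.of_eq (Primrec.eq.comp (.const 0) (.const 1)) fun _ => by simp [h]
    · exact PrimrecPred.of_eq (Primrec.eq.comp (.const 0) (.const 0)) fun _ => by simp [h]
  let alg : α →. Bool := fun J => (m (T₁ J)).bind fun b =>
    cond b ((e (I J)).map fun S => decide (test J S)) (m' (T₂ J))
  have halg : Partrec alg := by
    refine (hm.comp hT₁.to_comp).bind ?_
    refine Partrec.cond (c := fun x : α × Bool => x.2) Computable.snd ?_ ?_
    · exact (he.comp (hI.to_comp.comp .fst)).map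
        (htest.decide.to_comp.comp (Computable.fst.comp .fst) .snd).to₂
    · exact hm'.comp (hT₂.to_comp.comp .fst)
  refine ⟨alg, halg, ?_⟩
  rintro J hJ
  obtain ⟨hJ, hu₁, hu₂, hv₁, hv₂⟩ : J.1.IsInstance D ∧ J.2.1.On (rank J.1.1) ∧
    J.2.2.1.On (rank J.1.1) ∧ J.2.2.2.1.On (rank J.1.1) ∧ J.2.2.2.2.On (rank J.1.1) := hJ
  have haOn : (a J).On (rank J.1.1) := hv₁.inv.append hu₁
  have hcOn : (c J).On (rank (I J).1) := haOn.append (hu₂.append hv₂.inv)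
  have hIJ : (I J).IsInstance D := PCPInput.conj_isInstance hJ haOn
  have hgoal : (∃ x : FreeGroup (Fin J.1.2.length), x ≠ 1 ∧
      value J.1.1 J.2.1 * J.1.g x * value J.1.1 J.2.2.1 =
        value J.1.1 J.2.2.2.1 * J.1.h x * value J.1.1 J.2.2.2.2) ↔
      ∃ x, x ≠ 1 ∧ (I J).g x * value (I J).1 (c J) = (I J).h x :=
    exists_solution_iff_conj J.1 _ _ _ _
  obtain ⟨b, hb, hbc⟩ := hmem (T₁ J) ⟨hIJ.1, by simp, by simp, hcOn⟩
  have hbc' : b = true ↔ value (I J).1 (c J) = 1 := by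
    rw [hbc]
    simp [T₁]
  cases b
  · obtain ⟨b', hb', hbc''⟩ := hmem' (T₂ J) (by
      have hr := (hsqD _ hIJ.1).rank_eq
      refine ⟨⟨_, hIJ.1, rfl⟩, fun w hw => ?_, fun w hw => ?_, ?_⟩
      · exact hr ▸ Word.on_of_mem_diagonal hw
      · exact hr ▸ PCPInput.on_of_mem_graph hIJ hw
      · exact hr ▸ hcOn.shift _)
    refine ⟨b', Part.mem_bind hb hb', hbc''.trans ?_⟩
    refine ((hsqD _ hIJ.1).value_mem_iff hIJ (hrel _ hIJ.1) hcOn).trans (Iff.trans ?_ hgoal.symm)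
    refine exists_congr fun x => (and_iff_right_of_imp ?_).symm
    rintro hx rfl
    rw [map_one, map_one, one_mul] at hx
    exact absurd (hbc'.2 hx) (by simp)
  · obtain ⟨S, hS, hSOn, hSeq⟩ := heq (I J) hIJ
    refine ⟨decide (test J S), Part.mem_bind hb (Part.mem_map _ hS), ?_⟩
    refine decide_eq_true_iff.trans (Iff.trans ?_ hgoal.symm)
    refine (closure_sup_lawSubgroup_ne_bot_iff B hB hSOn).symm.trans ?_
    rw [hbc'.1 rfl, ← hSeq, Subgroup.ne_bot_iff_exists_ne_one]
    simp only [mul_one]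
    constructor
    · rintro ⟨⟨x, hx⟩, hx1⟩
      exact ⟨x, fun h => hx1 (Subtype.ext h), hx⟩
    · rintro ⟨x, hx1, hx⟩
      exact ⟨⟨x, hx⟩, fun h => hx1 (congrArg Subtype.val h)⟩

end Reduction

/-! ### Computing the presentation of the direct square -/

/-- The standard finite presentation of the direct square. -/
def FinPresentation.square (p : FinPresentation) : FinPresentation :=
  (p.1 + p.1, p.2 ++ p.2.map (Word.shift p.1) ++ Word.crossCommutators p.1)

theorem FinPresentation.primrec_square : Primrec FinPresentation.square := by
  refine (Primrec.nat_add.comp .fst .fst).pair ?_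
  exact Primrec.list_append.comp (Primrec.list_append.comp .snd (Primrec.list_map .snd
    (Word.primrec_shift.comp (Primrec.fst.comp .fst) .snd).to₂))
    (Word.primrec_crossCommutators.comp .fst)

theorem FinPresentation.presentsSquare (p : FinPresentation) : PresentsSquare p p.square where
  rank_eq := rfl
  relators_eq := by
    ext w
    simp [relators, square, rank, or_assoc]

theorem FinPresentation.valid_square {p : FinPresentation} (hp : Valid p) : Valid p.square := by
  intro w hw
  simp only [square, List.mem_append, List.mem_map] at hw
  rcases hw with (hw | ⟨w, hw, rfl⟩) | hw
  · exact (hp w hw).mono (Nat.le_add_left _ _)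
  · exact (hp w hw).shift _
  · exact Word.on_of_mem_crossCommutators hw

/-- The algorithm that decides the relators of the direct square: a word in the first half of the
letters, or in the second half, is passed to the algorithm for the factor, and any other word is
compared with the commutators. -/
def RecPresentation.squareRelator (x : RecPresentation × Word) : Part ℕ :=
  bif decide (∀ l ∈ x.2, l.1 < x.1.1) then x.1.2.eval (Encodable.encode x.2)
  else bif decide (∀ l ∈ x.2, x.1.1 ≤ l.1) then
    x.1.2.eval (Encodable.encode (x.2.map fun l => (l.1 - x.1.1, l.2) : Word))
  else Part.some (Encodable.encode (decide (∃ w ∈ Word.crossCommutators x.1.1, w = x.2)))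

theorem RecPresentation.partrec_squareRelator : Partrec RecPresentation.squareRelator := by
  have hn : Primrec fun x : RecPresentation × Word => x.1.1 := Primrec.fst.comp .fst
  have hc : Computable fun x : RecPresentation × Word => x.1.2 :=
    (Primrec.snd.comp .fst).to_comp
  have h₁ : PrimrecRel fun (w : Word) (n : ℕ) => ∀ l ∈ w, l.1 < n :=
    PrimrecRel.forall_mem_list (Primrec.nat_lt.comp (Primrec.fst.comp .fst) .snd)
  have h₂ : PrimrecRel fun (w : Word) (n : ℕ) => ∀ l ∈ w, n ≤ l.1 :=
    PrimrecRel.forall_mem_list (Primrec.nat_le.comp .snd (Primrec.fst.comp .fst))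
  have h₃ : PrimrecRel fun (L : List Word) (w : Word) => ∃ v ∈ L, v = w :=
    PrimrecRel.exists_mem_list Primrec.eq
  refine Partrec.cond (h₁.comp .snd hn).decide.to_comp
    (Nat.Partrec.Code.eval_part.comp hc (Primrec.encode.comp .snd).to_comp)
    (Partrec.cond (h₂.comp .snd hn).decide.to_comp
      (Nat.Partrec.Code.eval_part.comp hc (Primrec.encode.comp ?_).to_comp)
      (Primrec.encode.comp (h₃.comp (Word.primrec_crossCommutators.comp hn) .snd).decide).to_comp)
  exact Primrec.list_map .snd ((Primrec.nat_sub.comp (Primrec.fst.comp .snd)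
    (Primrec.fst.comp (Primrec.fst.comp .fst))).pair (Primrec.snd.comp .snd)).to₂

/-- By the `s-m-n` theorem, a code for the relator algorithm of the direct square is computed from
the presentation. -/
theorem RecPresentation.exists_square : ∃ sq : RecPresentation → RecPresentation, Primrec sq ∧
    ∀ p, (sq p).1 = p.1 + p.1 ∧
      ∀ w : Word, (sq p).2.eval (Encodable.encode w) = squareRelator (p, w) := by
  obtain ⟨c, hc⟩ := Nat.Partrec.Code.exists_code.1 partrec_squareRelator
  refine ⟨fun p => (p.1 + p.1, c.curry (Encodable.encode p)),
    (Primrec.nat_add.comp .fst .fst).pair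
      (Nat.Partrec.Code.primrec₂_curry.comp (.const c) Primrec.encode),
    fun p => ⟨rfl, fun w => ?_⟩⟩
  rw [Nat.Partrec.Code.eval_curry, hc, ← Encodable.encode_prod_val (a := p) (b := w)]
  simp only [Encodable.encodek, Part.coe_some, Part.bind_some]
  exact Part.map_id' (fun _ => rfl) _

theorem RecPresentation.mem_squareRelator {p : RecPresentation} (hp : Valid p) {w : Word}
    (hw : w.On (p.1 + p.1)) : (∃ b : Bool, Encodable.encode b ∈ squareRelator (p, w)) ∧
      (Encodable.encode true ∈ squareRelator (p, w) ↔
        w ∈ relators p ∪ Word.shift (rank p) '' relators p ∪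
          {w | w ∈ Word.crossCommutators (rank p)}) := by
  have hn : rank p = p.1 := rfl
  have hlow : ∀ v : Word, v ∈ Word.crossCommutators p.1 → ¬ v.On p.1 := by
    rintro v hv h
    obtain ⟨i, -, j, -, rfl⟩ := Word.mem_crossCommutators.1 hv
    have := h (p.1 + j, true) (by simp)
    simp at this
  have hhigh : ∀ v : Word, v ∈ Word.crossCommutators p.1 → ¬ ∀ l ∈ v, p.1 ≤ l.1 := by
    rintro v hv h
    obtain ⟨i, hi, j, -, rfl⟩ := Word.mem_crossCommutators.1 hv
    have := h (i, true) (by simp)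
    simp only at this
    omega
  by_cases h₁ : ∀ l ∈ w, l.1 < p.1
  · have e : squareRelator (p, w) = p.2.eval (Encodable.encode w) := by
      simp only [squareRelator, decide_eq_true h₁, cond_true]
    rw [e]
    refine ⟨hp w h₁, fun h => Or.inl (Or.inl ⟨h₁, h⟩), ?_⟩
    rintro ((h | ⟨v, hv, rfl⟩) | h)
    · exact h.2
    · -- a shifted word in the first half of the letters is empty
      cases v with
      | nil => exact hv.2
      | cons l v =>
        have := h₁ (p.1 + l.1, l.2) (by simp [Word.shift, hn])
        simp at this
    · exact absurd h₁ (hlow w h)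
  by_cases h₂ : ∀ l ∈ w, p.1 ≤ l.1
  · obtain ⟨v, hv, rfl⟩ : ∃ v : Word, v.On p.1 ∧ v.shift p.1 = w := by
      refine ⟨w.map fun l => (l.1 - p.1, l.2), fun l hl => ?_, ?_⟩
      · obtain ⟨l', hl', rfl⟩ := List.mem_map.1 hl
        have := hw l' hl'
        have := h₂ l' hl'
        simp only
        omega
      · rw [Word.shift, List.map_map]
        refine (List.map_congr_left fun l hl => ?_).trans (List.map_id w)
        have := h₂ l hl
        exact Prod.ext (by simp; omega) rfl
    have e : squareRelator (p, v.shift p.1) = p.2.eval (Encodable.encode v) := by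
      have : ((v.shift p.1).map fun l => (l.1 - p.1, l.2) : Word) = v := by
        simp [Word.shift, Function.comp_def]
      simp only [squareRelator, decide_eq_false h₁, decide_eq_true h₂, cond_true, cond_false, this]
    rw [e]
    have hinj : Function.Injective (Word.shift p.1) := by
      refine List.map_injective_iff.2 fun x y hxy => ?_
      simp only [Prod.mk.injEq, Nat.add_left_cancel_iff] at hxy
      exact Prod.ext hxy.1 hxy.2
    refine ⟨hp v hv, fun h => Or.inl (Or.inr ⟨v, ⟨hv, h⟩, rfl⟩), ?_⟩
    rintro ((h | ⟨v', hv', h⟩) | h)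
    · exact absurd h.1 h₁
    · rw [← hinj h]
      exact hv'.2
    · exact absurd h₂ (hhigh _ h)
  · have e : squareRelator (p, w) = Part.some (Encodable.encode
        (decide (∃ v ∈ Word.crossCommutators p.1, v = w))) := by
      simp only [squareRelator, h₁, h₂, decide_false, cond_false]
    rw [e]
    refine ⟨⟨_, Part.mem_some _⟩, ?_⟩
    rw [Part.mem_some_iff, Encodable.encode_inj, eq_comm, decide_eq_true_iff, exists_eq_right]
    refine ⟨Or.inr, ?_⟩
    rintro ((h | ⟨v, hv, rfl⟩) | h)
    · exact absurd h.1 h₁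
    · refine absurd (fun l hl => ?_) h₂
      obtain ⟨l', -, rfl⟩ := List.mem_map.1 hl
      exact Nat.le_add_right _ _
    · exact h

/-! ### The classes of recursively and finitely presented groups -/

theorem GroupVariety.mem_of_presentsSquare {P : Type} [PresentationData P] (B : GroupVariety)
    {p q : P} (hq : PresentsSquare p q) (hp : ∀ w ∈ relators p, w.On (rank p))
    (h : B.Mem (Grp p)) : B.Mem (Grp q) := by
  obtain ⟨φ, hφ, -⟩ := hq.exists_hom hp
  exact B.mem_of_injective φ hφ (B.mem_prod h)

/-- Both the uniform and the non-uniform reduction, for a set `C` of presentations closed under a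
computable formation of direct squares. -/
theorem npcpDecidable_of_square_mem {P : Type} [PresentationData P] [Primcodable P]
    (B : GroupVariety) (hB : B.IsProper) {C : Set P} (hrank : Primrec (rank : P → ℕ))
    (hrel : ∀ p ∈ C, ∀ w ∈ relators p, w.On (rank p)) {sq : P → P} (hsq : Primrec sq)
    (hsqC : ∀ p ∈ C, PresentsSquare p (sq p)) (hmem : ∀ p ∈ C, sq p ∈ C) :
    (EqualiserComputable B C → ProductMembershipDecidable C → NPCPDecidable C) ∧
    ((∀ p ∈ C, EqualiserComputable B {p}) → (∀ p ∈ C, ProductMembershipDecidable {p}) →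
      ∀ p ∈ C, NPCPDecidable {p}) := by
  refine ⟨fun hE hM => npcpDecidable_of_presentsSquare B hB hrank hrel hsq hsqC hE hM
    (hM.mono (Set.image_subset_iff.2 hmem)), fun hE hM p hp => ?_⟩
  have hsub : ∀ q ∈ ({p} : Set P), q ∈ C := fun q hq => Set.mem_singleton_iff.1 hq ▸ hp
  refine npcpDecidable_of_presentsSquare B hB hrank (fun q hq => hrel q (hsub q hq)) hsq
    (fun q hq => hsqC q (hsub q hq)) (hE p hp) (hM p hp) ?_
  rw [Set.image_singleton]
  exact hM _ (hmem p hp)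

theorem proposition5p1 (𝔅 : GroupVariety) (hproper : 𝔅.IsProper) :
    -- recursively presented groups, given by recursive presentations
    (𝔅.HasFreeObjects 𝔅.RecPres →
      -- one algorithm for all groups in the class
      (EqualiserComputable 𝔅 (presentationsOf RecPresentation 𝔅.RecPres) →
        ProductMembershipDecidable (presentationsOf RecPresentation 𝔅.RecPres) →
        NPCPDecidable (presentationsOf RecPresentation 𝔅.RecPres)) ∧
      -- one algorithm for each group in the class
      ((∀ p ∈ presentationsOf RecPresentation 𝔅.RecPres, EqualiserComputable 𝔅 {p}) →
        (∀ p ∈ presentationsOf RecPresentation 𝔅.RecPres, ProductMembershipDecidable {p}) →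
        ∀ p ∈ presentationsOf RecPresentation 𝔅.RecPres, NPCPDecidable {p})) ∧
    -- finitely presented groups, given by finite presentations
    (𝔅.HasFreeObjects 𝔅.FinPres →
      (EqualiserComputable 𝔅 (presentationsOf FinPresentation 𝔅.FinPres) →
        ProductMembershipDecidable (presentationsOf FinPresentation 𝔅.FinPres) →
        NPCPDecidable (presentationsOf FinPresentation 𝔅.FinPres)) ∧
      ((∀ p ∈ presentationsOf FinPresentation 𝔅.FinPres, EqualiserComputable 𝔅 {p}) →
        (∀ p ∈ presentationsOf FinPresentation 𝔅.FinPres, ProductMembershipDecidable {p}) →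
        ∀ p ∈ presentationsOf FinPresentation 𝔅.FinPres, NPCPDecidable {p})) := by
  refine ⟨fun _ => ?_, fun _ => ?_⟩
  · obtain ⟨sq, hsq, hsq'⟩ := RecPresentation.exists_square
    have hrel : ∀ p : RecPresentation, ∀ w ∈ relators p, w.On (rank p) := fun p w hw => hw.1
    have hsquare : ∀ p : RecPresentation, Valid p → PresentsSquare p (sq p) := fun p hp => by
      refine ⟨(hsq' p).1, ?_⟩
      ext w
      have key : ∀ hw : w.On (p.1 + p.1), _ := fun hw =>
        (RecPresentation.mem_squareRelator hp hw).2
      rw [← (hsq' p).2] at key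
      refine ⟨fun hw => (key ((hsq' p).1 ▸ hw.1)).1 hw.2, fun hw => ?_⟩
      have hOn : w.On (p.1 + p.1) := by
        rcases hw with (hw | ⟨v, hv, rfl⟩) | hw
        · exact hw.1.mono (Nat.le_add_left _ _)
        · exact hv.1.shift _
        · exact Word.on_of_mem_crossCommutators hw
      exact ⟨show w.On (sq p).1 from (hsq' p).1 ▸ hOn, (key hOn).2 hw⟩
    refine npcpDecidable_of_square_mem 𝔅 hproper Primrec.fst (fun p _ => hrel p) hsq
      (fun p hp => hsquare p hp.1) fun p hp => ?_
    have hvalid : Valid (sq p) := fun w hw => by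
      rw [(hsq' p).2]
      exact (RecPresentation.mem_squareRelator hp.1 ((hsq' p).1 ▸ hw)).1
    exact ⟨hvalid, 𝔅.mem_of_presentsSquare (hsquare p hp.1) (hrel p) hp.2.1,
      sq p, hvalid, ⟨MulEquiv.refl _⟩⟩
  · refine npcpDecidable_of_square_mem 𝔅 hproper Primrec.fst (fun p hp => hp.1)
      FinPresentation.primrec_square (fun p _ => p.presentsSquare) fun p hp =>
      ⟨FinPresentation.valid_square hp.1,
        𝔅.mem_of_presentsSquare p.presentsSquare hp.1 hp.2.1, ?_⟩
    have : Finite (Word.toFree (rank p.square) '' relators p.square) :=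
      ((List.finite_toSet p.square.2).image _).to_subtype
    infer_instance
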